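/- Let $n,q\in\mathbb N$. A law $\nu$ on $\mathbb R^n$ is elliptical, $\nu = ELL_n(\mu,\Sigma,\psi)$, if its characteristic function is $t\mapsto e^{i t'\mu}\,\psi(t'\Sigma t)$ with $\psi(0)=1$; it has density generator $g\ge 0$ (measurable, $0<\int_0^\infty z^{n/2-1}g(z)\,dz<\infty$) if it has the density $x\mapsto \frac{c_n}{\sqrt{|\Sigma|}}\,g\big((x-\mu)'\Sigma^{-1}(x-\mu)\big)$, where $c_n=\frac{\Gamma(n/2)}{\pi^{n/2}}\big(\int_0^\infty z^{n/2-1}g(z)\,dz\big)^{-1}$. Let $\alpha,\beta:\mathbb R^q\to[0,\infty)$ be measurable and let $H$ be a probability law on $\mathbb R^q$. A random vector $Y$ in $\mathbb R^n$ has the location-scale mixture of elliptical distribution with parameters $(\mu,\Sigma,\delta)$ (and common $\psi,g,\alpha,\beta,H$), where $\mu,\delta\in\mathbb R^n$ and $\Sigma$ is positive definite, if $$Y\overset{d}{=}\mu+\alpha(Z)X+\beta(Z)\delta,$$ where $X\sim ELL_n(0,\Sigma,\psi)$ has density generator $g$ and $Z\sim H$ is independent of $X$. Write $Y_1\le_{cx}Y_2$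 if $E f(Y_1)\le E f(Y_2)$ for every convex $f:\mathbb R^n\to\mathbb R$ for which both expectations are well defined in $[-\infty,\infty]$. Let $Y_1,Y_2$ be location-scale mixtures of elliptical distributions with parameters $(\mu_1,\Sigma_1,\delta_1)$ and $(\mu_2,\Sigma_2,\delta_2)$ respectively and with the same $\psi,g,\alpha,\beta,H$. 1. If $\mu_1=\mu_2$, $\delta_1=\delta_2$ and $\Sigma_2-\Sigma_1$ is positive semi-definite, then $Y_1\le_{cx}Y_2$. 2. Suppose that $Y_1$ and $Y_2$ have finite means and that neither $\alpha(Z)=0$ almost surely nor $\beta(Z)=0$ almost surely, for $Z\sim H$. If $\mu_1=\mu_2$, then $Y_1\le_{cx}Y_2$ if and only if $\delta_1=\delta_2$ and $\Sigma_2-\Sigma_1$ is positive semi-definite. 3. Suppose that $Y_1$ and $Y_2$ have finite means and that $\alpha(Z)$ is not almost surely $0$, for $Z\sim H$. If $\delta_1=\delta_2$, then $Y_1\le_{cx}Y_2$ if and only if $\mu_1=\mu_2$ and $\Sigma_2-\Sigma_1$ is positive semi-definite. -/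

import Mathlib

open MeasureTheory ProbabilityTheory
open scoped ENNReal Matrix RealInnerProductSpace

/-- The quadratic form `xᵀ A x`. -/
noncomputable def quadForm {n : ℕ} (A : Matrix (Fin n) (Fin n) ℝ)
    (x : EuclideanSpace ℝ (Fin n)) : ℝ :=
  x.ofLp ⬝ᵥ (A *ᵥ x.ofLp)

/-- The probability measure `ν` on `ℝⁿ` is the elliptical law `ELL_n(μ, S, ψ)`: its characteristic
function is `t ↦ exp(i tᵀμ) ψ(tᵀ S t)`, where `ψ 0 = 1`. -/
structure IsElliptical {n : ℕ} (ν : Measure (EuclideanSpace ℝ (Fin n)))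
    (μ : EuclideanSpace ℝ (Fin n)) (S : Matrix (Fin n) (Fin n) ℝ) (ψ : ℝ → ℝ) : Prop where
  isProbabilityMeasure : IsProbabilityMeasure ν
  generator_zero : ψ 0 = 1
  charFun_eq : ∀ t : EuclideanSpace ℝ (Fin n),
    charFun ν t = Complex.exp (Complex.I * ((⟪t, μ⟫ : ℝ) : ℂ)) * ((ψ (quadForm S t) : ℝ) : ℂ)

/-- `g` is an `n`-dimensional density generator: it is nonnegative (and measurable) and
`0 < ∫₀^∞ z^(n/2-1) g(z) dz < ∞`. -/
structure IsDensityGenerator (n : ℕ) (g : ℝ → ℝ) : Prop where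
  measurable : Measurable g
  nonneg : ∀ z, 0 ≤ z → 0 ≤ g z
  integrableOn : IntegrableOn (fun z : ℝ => z ^ ((n : ℝ) / 2 - 1) * g z) (Set.Ioi 0)
  integral_pos : 0 < ∫ z in Set.Ioi (0 : ℝ), z ^ ((n : ℝ) / 2 - 1) * g z

/-- The normalizing constant
`c_n = Γ(n/2) / π^(n/2) * (∫₀^∞ z^(n/2-1) g(z) dz)⁻¹`. -/
noncomputable def normalizingConst (n : ℕ) (g : ℝ → ℝ) : ℝ :=
  Real.Gamma ((n : ℝ) / 2) / Real.pi ^ ((n : ℝ) / 2) *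
    (∫ z in Set.Ioi (0 : ℝ), z ^ ((n : ℝ) / 2 - 1) * g z)⁻¹

/-- `ν` has the elliptical Lebesgue density
`x ↦ c_n / √|S| * g((x - μ)ᵀ S⁻¹ (x - μ))` with density generator `g`. -/
structure HasEllipticalDensity {n : ℕ} (ν : Measure (EuclideanSpace ℝ (Fin n)))
    (μ : EuclideanSpace ℝ (Fin n)) (S : Matrix (Fin n) (Fin n) ℝ) (g : ℝ → ℝ) : Prop where
  isDensityGenerator : IsDensityGenerator n g
  eq_withDensity : ν = volume.withDensity (fun x =>
    ENNReal.ofReal (normalizingConst n g / Real.sqrt S.det * g (quadForm S⁻¹ (x - μ))))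

/-- The random vector `Y` on `(Ω, P)` has the location-scale mixture of elliptical distribution
`LSE_n(μ, S, δ, α, β, H)` with characteristic generator `ψ` and density generator `g`:
`Y` has the law of `μ + α(Z) X + β(Z) δ`, where `X ∼ ELL_n(0, S, ψ)` has density generator `g`,
`S` is positive definite, and `Z` is a `q`-dimensional random vector with law `H`, independent of
`X`. The joint law of the independent pair `(X, Z)` is the product measure `ν.prod H`. -/
structure IsLSE {n q : ℕ} {Ω : Type*} [MeasurableSpace Ω] (P : Measure Ω)
    (Y : Ω → EuclideanSpace ℝ (Fin n))
    (μ : EuclideanSpace ℝ (Fin n)) (S : Matrix (Fin n) (Fin n) ℝ)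
    (δ : EuclideanSpace ℝ (Fin n)) (ψ g : ℝ → ℝ)
    (α β : EuclideanSpace ℝ (Fin q) → ℝ) (H : Measure (EuclideanSpace ℝ (Fin q))) : Prop where
  posDef : S.PosDef
  isProbabilityMeasure : IsProbabilityMeasure H
  measurable_scale : Measurable α
  measurable_location : Measurable β
  scale_nonneg : ∀ z, 0 ≤ α z
  location_nonneg : ∀ z, 0 ≤ β z
  representation : ∃ ν : Measure (EuclideanSpace ℝ (Fin n)),
    IsElliptical ν 0 S ψ ∧ HasEllipticalDensity ν 0 S g ∧
      HasLaw Y ((ν.prod H).map (fun p => μ + α p.2 • p.1 + β p.2 • δ)) P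

/-- The expectation of `h` is well defined (as an extended real number): the positive part or the
negative part of `h` has finite integral. -/
def ExpectationWellDefined {Ω : Type*} [MeasurableSpace Ω] (P : Measure Ω) (h : Ω → ℝ) : Prop :=
  ∫⁻ ω, ENNReal.ofReal (h ω) ∂P ≠ ∞ ∨ ∫⁻ ω, ENNReal.ofReal (-h ω) ∂P ≠ ∞

/-- The expectation `E[h] = E[h⁺] - E[h⁻]` as an extended real number; meaningful when
`ExpectationWellDefined P h` holds. -/
noncomputable def extExpectation {Ω : Type*} [MeasurableSpace Ω] (P : Measure Ω) (h : Ω → ℝ) :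
    EReal :=
  ((∫⁻ ω, ENNReal.ofReal (h ω) ∂P : ℝ≥0∞) : EReal) -
    ((∫⁻ ω, ENNReal.ofReal (-h ω) ∂P : ℝ≥0∞) : EReal)

/-- The convex order `Y₁ ≤_cx Y₂`: `E f(Y₁) ≤ E f(Y₂)` for every convex `f : ℝⁿ → ℝ`, whenever the
two expectations are well defined. -/
def ConvexOrder {n : ℕ} {Ω₁ Ω₂ : Type*} [MeasurableSpace Ω₁] [MeasurableSpace Ω₂]
    (P₁ : Measure Ω₁) (Y₁ : Ω₁ → EuclideanSpace ℝ (Fin n))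
    (P₂ : Measure Ω₂) (Y₂ : Ω₂ → EuclideanSpace ℝ (Fin n)) : Prop :=
  ∀ f : EuclideanSpace ℝ (Fin n) → ℝ, ConvexOn ℝ Set.univ f →
    ExpectationWellDefined P₁ (fun ω => f (Y₁ ω)) →
    ExpectationWellDefined P₂ (fun ω => f (Y₂ ω)) →
      extExpectation P₁ (fun ω => f (Y₁ ω)) ≤ extExpectation P₂ (fun ω => f (Y₂ ω))

/-! ### Matrix decompositions and the convex hull of sign vectors -/

section Matrices

variable {n : ℕ}

/-! Sufficiency is a pathwise Jensen argument. Simultaneous diagonalization writes `S₂ = P Pᵀ` and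
`S₁ = P D Pᵀ` with entries of `D` in `[0, 1]`. The vector of square roots of these entries lies in
the cube `[-1, 1]ⁿ`, so it is a convex combination of sign vectors `ε`. For spherical `X₀`, `P
diag(√d) X₀` has the law of the first elliptical vector, while every `P diag(ε) X₀` has that of the
second. Hence `Y₁` is, on a common space, a convex combination of copies of `Y₂`
(`IsLSE.convexOrder_of_posSemidef`), and no moments are needed.

For necessity, linear test functions equate the means `μ + E[β(Z)] δ`, which identifies `δ` or `μ`.
If then `tᵀ S₁ t > tᵀ S₂ t` for some `t`, the test function `√(1 + ⟪t, y⟫²)` gives a contradiction: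
it is strictly convex along `t`, and its linear growth makes finite means enough
(`IsLSE.quadForm_le_of_convexOrder`). -/

theorem Matrix.IsHermitian.exists_orthogonal_diagonal {A : Matrix (Fin n) (Fin n) ℝ}
    (hA : A.IsHermitian) : ∃ (U : Matrix (Fin n) (Fin n) ℝ) (d : Fin n → ℝ),
      U * Uᵀ = 1 ∧ Uᵀ * U = 1 ∧ A = U * Matrix.diagonal d * Uᵀ := by
  refine ⟨hA.eigenvectorUnitary, hA.eigenvalues, ?_, ?_, ?_⟩
  · simpa [Matrix.star_eq_conjTranspose] using
      Unitary.coe_mul_star_self hA.eigenvectorUnitary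
  · simpa [Matrix.star_eq_conjTranspose] using
      Unitary.coe_star_mul_self hA.eigenvectorUnitary
  · have h := hA.spectral_theorem
    rw [Unitary.conjStarAlgAut_apply] at h
    simpa [Matrix.star_eq_conjTranspose, Function.comp_def] using h

theorem Matrix.PosDef.exists_isUnit_mul_transpose {A : Matrix (Fin n) (Fin n) ℝ}
    (hA : A.PosDef) : ∃ P R : Matrix (Fin n) (Fin n) ℝ, P * R = 1 ∧ R * P = 1 ∧ A = P * Pᵀ := by
  obtain ⟨U, d, h1, h2, h3⟩ := hA.1.exists_orthogonal_diagonal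
  -- Semidefiniteness gives nonnegative eigenvalues; the positive determinant excludes zero.
  have hd : ∀ i, 0 < d i := by
    have : (Uᵀ * A * U).PosSemidef := by
      simpa using hA.posSemidef.conjTranspose_mul_mul_same U
    have e : Uᵀ * A * U = Matrix.diagonal d := by
      rw [h3]
      calc Uᵀ * (U * Matrix.diagonal d * Uᵀ) * U
          = (Uᵀ * U) * Matrix.diagonal d * (Uᵀ * U) := by simp only [Matrix.mul_assoc]
        _ = _ := by rw [h2]; simp
    rw [e, Matrix.posSemidef_diagonal_iff] at this
    intro i
    refine (this i).lt_of_ne' fun hi => ?_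
    have hdet := hA.det_pos
    rw [h3, Matrix.det_mul, Matrix.det_mul, Matrix.det_diagonal,
      Finset.prod_eq_zero (Finset.mem_univ i) hi] at hdet
    simp at hdet
  have hs : ∀ i, √(d i) * (√(d i))⁻¹ = 1 := fun i =>
    mul_inv_cancel₀ (Real.sqrt_pos.2 (hd i)).ne'
  have hP : (U * Matrix.diagonal fun i => √(d i)) * ((Matrix.diagonal fun i => (√(d i))⁻¹) * Uᵀ)
      = 1 := by
    calc _ = U * ((Matrix.diagonal fun i => √(d i)) * (Matrix.diagonal fun i => (√(d i))⁻¹)) * Uᵀ := by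
          simp only [Matrix.mul_assoc]
      _ = 1 := by simp [Matrix.diagonal_mul_diagonal, hs, h1]
  refine ⟨_, _, hP, mul_eq_one_comm.1 hP, ?_⟩
  rw [Matrix.transpose_mul, Matrix.diagonal_transpose]
  calc A = U * Matrix.diagonal d * Uᵀ := h3
    _ = U * ((Matrix.diagonal fun i => √(d i)) * (Matrix.diagonal fun i => √(d i))) * Uᵀ := by
      simp [Matrix.diagonal_mul_diagonal, fun i => Real.mul_self_sqrt (hd i).le]
    _ = _ := by simp only [Matrix.mul_assoc]

/-- Whiten `S₂` to the identity, then rotate so that the transformed `S₁` is diagonal; rotations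
preserve the identity. The order between the two matrices then bounds the diagonal by 1. -/
theorem exists_simultaneous_diagonalization {S₁ S₂ : Matrix (Fin n) (Fin n) ℝ}
    (h₁ : S₁.PosSemidef) (h₂ : S₂.PosDef) (h : (S₂ - S₁).PosSemidef) :
    ∃ (P R : Matrix (Fin n) (Fin n) ℝ) (d : Fin n → ℝ), R * P = 1 ∧
      S₂ = P * Pᵀ ∧ S₁ = P * Matrix.diagonal d * Pᵀ ∧ ∀ i, 0 ≤ d i ∧ d i ≤ 1 := by
  obtain ⟨P, R, hPR, hRP, hS⟩ := h₂.exists_isUnit_mul_transpose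
  have hM : (R * S₁ * Rᵀ).PosSemidef := by simpa using h₁.mul_mul_conjTranspose_same R
  obtain ⟨U, d, hU, hU', hd⟩ := hM.1.exists_orthogonal_diagonal
  have hRP' : Rᵀ * Pᵀ = 1 := by rw [← Matrix.transpose_mul, hPR, Matrix.transpose_one]
  have hPR' : Pᵀ * Rᵀ = 1 := by rw [← Matrix.transpose_mul, hRP, Matrix.transpose_one]
  have hQ : (P * U) * (Uᵀ * R) = 1 := by
    calc _ = P * (U * Uᵀ) * R := by simp only [Matrix.mul_assoc]
      _ = 1 := by rw [hU, Matrix.mul_one, hPR]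
  have hQ' : (Uᵀ * R) * (P * U) = 1 := mul_eq_one_comm.1 hQ
  have e1 : Uᵀ * R * S₁ * (Uᵀ * R)ᵀ = Matrix.diagonal d := by
    calc _ = Uᵀ * (R * S₁ * Rᵀ) * U := by
          simp only [Matrix.mul_assoc, Matrix.transpose_mul, Matrix.transpose_transpose]
      _ = (Uᵀ * U) * Matrix.diagonal d * (Uᵀ * U) := by rw [hd]; simp only [Matrix.mul_assoc]
      _ = _ := by rw [hU']; simp
  have e2 : Uᵀ * R * S₂ * (Uᵀ * R)ᵀ = 1 := by
    calc _ = Uᵀ * (R * P) * (Pᵀ * Rᵀ) * U := by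
          rw [hS]; simp only [Matrix.mul_assoc, Matrix.transpose_mul, Matrix.transpose_transpose]
      _ = _ := by rw [hRP, hPR']; simp [hU']
  refine ⟨P * U, Uᵀ * R, d, hQ', ?_, ?_, fun i => ⟨?_, ?_⟩⟩
  · calc S₂ = P * (U * Uᵀ) * Pᵀ := by rw [hU, hS, Matrix.mul_one]
      _ = _ := by simp only [Matrix.mul_assoc, Matrix.transpose_mul]
  · calc S₁ = (P * R) * S₁ * (Rᵀ * Pᵀ) := by rw [hPR, hRP']; simp
      _ = P * (R * S₁ * Rᵀ) * Pᵀ := by simp only [Matrix.mul_assoc]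
      _ = _ := by rw [hd]; simp only [Matrix.mul_assoc, Matrix.transpose_mul]
  · have := h₁.mul_mul_conjTranspose_same (Uᵀ * R)
    rw [Matrix.conjTranspose_eq_transpose_of_trivial, e1, Matrix.posSemidef_diagonal_iff] at this
    exact this i
  · have := h.mul_mul_conjTranspose_same (Uᵀ * R)
    rw [Matrix.conjTranspose_eq_transpose_of_trivial, Matrix.mul_sub, Matrix.sub_mul, e1, e2,
      ← Matrix.diagonal_one, Matrix.diagonal_sub, Matrix.posSemidef_diagonal_iff] at this
    simpa using this i

/-- The cube is the convex hull of its vertices, since the hull of a product is the product of the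
hulls. -/
theorem exists_sum_signs {d : Fin n → ℝ} (hd : ∀ i, |d i| ≤ 1) :
    ∃ (ι : Type) (_ : Fintype ι) (w : ι → ℝ) (ε : ι → Fin n → ℝ), (∀ j, 0 ≤ w j) ∧
      ∑ j, w j = 1 ∧ (∀ j i, ε j i * ε j i = 1) ∧ ∑ j, w j • ε j = d := by
  have h : d ∈ convexHull ℝ (Set.univ.pi fun _ : Fin n => ({-1, 1} : Set ℝ)) := by
    rw [convexHull_pi]
    intro i _
    rw [convexHull_pair, segment_eq_Icc (by norm_num)]
    exact abs_le.1 (hd i)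
  obtain ⟨ι, _, w, ε, hw, hw1, hε, hs⟩ := mem_convexHull_iff_exists_fintype.1 h
  refine ⟨ι, _, w, ε, hw, hw1, fun j i => ?_, hs⟩
  rcases hε j i (Set.mem_univ i) with h | h <;> simp_all

end Matrices

/-! ### Linear images and projections of elliptical laws -/

section Elliptical

variable {n : ℕ} {ν ν' : Measure (EuclideanSpace ℝ (Fin n))} {S : Matrix (Fin n) (Fin n) ℝ}
  {ψ : ℝ → ℝ}

theorem IsElliptical.ext {μ : EuclideanSpace ℝ (Fin n)} (h : IsElliptical ν μ S ψ)
    (h' : IsElliptical ν' μ S ψ) : ν = ν' := by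
  have := h.isProbabilityMeasure
  have := h'.isProbabilityMeasure
  exact Measure.ext_of_charFun (funext fun t => by rw [h.charFun_eq, h'.charFun_eq])

theorem IsElliptical.map_toEuclideanCLM (h : IsElliptical ν 0 S ψ)
    (M : Matrix (Fin n) (Fin n) ℝ) :
    IsElliptical (ν.map (Matrix.toEuclideanCLM (𝕜 := ℝ) M)) 0 (M * S * Mᵀ) ψ := by
  have := h.isProbabilityMeasure
  refine ⟨Measure.isProbabilityMeasure_map (by fun_prop), h.generator_zero, fun t => ?_⟩
  have e : charFun (ν.map (Matrix.toEuclideanCLM (𝕜 := ℝ) M)) t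
      = charFun ν (Matrix.toEuclideanCLM (𝕜 := ℝ) Mᵀ t) := by
    rw [charFun_apply, charFun_apply, integral_map (by fun_prop) (by fun_prop)]
    refine integral_congr_ae (.of_forall fun x => ?_)
    have : Matrix.toEuclideanCLM (𝕜 := ℝ) Mᵀ
        = ContinuousLinearMap.adjoint (Matrix.toEuclideanCLM (𝕜 := ℝ) M) := by
      rw [← ContinuousLinearMap.star_eq_adjoint, ← map_star, Matrix.star_eq_conjTranspose,
        Matrix.conjTranspose_eq_transpose_of_trivial]
    simp only [this, ContinuousLinearMap.adjoint_inner_right]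
  rw [e, h.charFun_eq]
  congr 3
  · simp
  · simp only [quadForm, Matrix.ofLp_toEuclideanCLM]
    rw [← Matrix.mulVec_mulVec, ← Matrix.mulVec_mulVec, Matrix.dotProduct_mulVec _ M,
      Matrix.mulVec_transpose]

theorem IsElliptical.map_neg (h : IsElliptical ν 0 S ψ) : ν.map (fun x => -x) = ν := by
  have h' := h.map_toEuclideanCLM (-1)
  have e : (-1 : Matrix (Fin n) (Fin n) ℝ) * S * (-1)ᵀ = S := by simp
  rw [e] at h'
  have := h'.ext h
  convert this using 2
  ext1 x
  simp

theorem IsElliptical.charFun_map_inner (h : IsElliptical ν 0 S ψ)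
    (t : EuclideanSpace ℝ (Fin n)) (u : ℝ) :
    charFun (ν.map fun x => ⟪t, x⟫) u = ((ψ (u ^ 2 * quadForm S t) : ℝ) : ℂ) := by
  have e : charFun (ν.map fun x => ⟪t, x⟫) u = charFun ν (u • t) := by
    rw [charFun_apply, charFun_apply, integral_map (by fun_prop) (by fun_prop)]
    refine integral_congr_ae (.of_forall fun x => ?_)
    simp [real_inner_smul_right, real_inner_comm, mul_comm]
  rw [e, h.charFun_eq]
  simp [quadForm, Matrix.mulVec_smul, sq, mul_assoc]

/-- The one-dimensional projections of two elliptical laws with the same generator differ by a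
scale factor only. -/
theorem IsElliptical.map_inner_eq_map_mul {S' : Matrix (Fin n) (Fin n) ℝ}
    (h : IsElliptical ν 0 S ψ) (h' : IsElliptical ν' 0 S' ψ) {t : EuclideanSpace ℝ (Fin n)}
    {θ : ℝ} (hθ : quadForm S' t = θ ^ 2 * quadForm S t) :
    ν'.map (fun x => ⟪t, x⟫) = ν.map (fun x => θ * ⟪t, x⟫) := by
  have := h.isProbabilityMeasure
  have := h'.isProbabilityMeasure
  have e : ν.map (fun x => θ * ⟪t, x⟫) = (ν.map fun x => ⟪t, x⟫).map (fun y => θ * y) := by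
    rw [Measure.map_map (by fun_prop) (by fun_prop)]; rfl
  have : IsProbabilityMeasure (ν.map fun x => ⟪t, x⟫) :=
    Measure.isProbabilityMeasure_map (by fun_prop)
  have : IsProbabilityMeasure (ν'.map fun x => ⟪t, x⟫) :=
    Measure.isProbabilityMeasure_map (by fun_prop)
  rw [e]
  refine Measure.ext_of_charFun (funext fun u => ?_)
  rw [charFun_map_mul, h.charFun_map_inner, h'.charFun_map_inner, hθ]
  congr 2
  ring

/-- A proper hyperplane is Lebesgue-null. This is the only use of the density: it makes projections
of the elliptical vector nondegenerate. -/
theorem HasEllipticalDensity.measure_inner_eq_zero {g : ℝ → ℝ} {μ : EuclideanSpace ℝ (Fin n)}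
    (h : HasEllipticalDensity ν μ S g) {t : EuclideanSpace ℝ (Fin n)} (ht : t ≠ 0) :
    ν {x | ⟪t, x⟫ = 0} = 0 := by
  rw [h.eq_withDensity]
  refine withDensity_absolutelyContinuous _ _ ?_
  have := Measure.addHaar_submodule (volume : Measure (EuclideanSpace ℝ (Fin n)))
    (LinearMap.ker (innerSL ℝ t : EuclideanSpace ℝ (Fin n) →L[ℝ] ℝ).toLinearMap) (by
      intro h
      have : t ∈ LinearMap.ker (innerSL ℝ t : EuclideanSpace ℝ (Fin n) →L[ℝ] ℝ).toLinearMap := by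
        rw [h]; trivial
      simp at this
      exact ht this)
  convert this using 2
  ext x
  simp

end Elliptical

/-! ### Extended expectations through positive and negative parts -/

section Expectation

variable {Ω : Type*} [MeasurableSpace Ω] {P : Measure Ω}

theorem Integrable.expectationWellDefined {h : Ω → ℝ} (hh : Integrable h P) :
    ExpectationWellDefined P h :=
  Or.inl ((lintegral_mono fun ω => Real.ofReal_le_enorm (h ω)).trans_lt hh.2).ne

theorem extExpectation_eq_integral {h : Ω → ℝ} (hh : Integrable h P) :
    extExpectation P h = ((∫ ω, h ω ∂P : ℝ) : EReal) := by
  have h1 : ∫⁻ ω, ENNReal.ofReal (h ω) ∂P ≠ ∞ :=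
    ((lintegral_mono fun ω => Real.ofReal_le_enorm (h ω)).trans_lt hh.2).ne
  have h2 : ∫⁻ ω, ENNReal.ofReal (-h ω) ∂P ≠ ∞ :=
    ((lintegral_mono fun ω => Real.ofReal_le_enorm (-h ω)).trans_lt hh.neg.2).ne
  rw [integral_eq_lintegral_pos_part_sub_lintegral_neg_part hh, EReal.coe_sub,
    EReal.coe_ennreal_toReal h1, EReal.coe_ennreal_toReal h2, extExpectation]

/-- A Jensen-type comparison of positive and negative parts. -/
theorem lintegral_parts_le_of_le_sum {ι : Type*} [Fintype ι] {w : ι → ℝ} (hw : ∀ j, 0 ≤ w j)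
    (hw1 : ∑ j, w j = 1) {F : Ω → ℝ} {G : ι → Ω → ℝ} (hF : Measurable F)
    (hG : ∀ j, Measurable (G j)) (hFG : ∀ ω, F ω ≤ ∑ j, w j * G j ω) {a b : ℝ≥0∞}
    (ha : ∀ j, ∫⁻ ω, ENNReal.ofReal (G j ω) ∂P = a)
    (hb : ∀ j, ∫⁻ ω, ENNReal.ofReal (-G j ω) ∂P = b) :
    ∫⁻ ω, ENNReal.ofReal (F ω) ∂P + b ≤ ∫⁻ ω, ENNReal.ofReal (-F ω) ∂P + a := by
  have hsum : ∀ c : ℝ≥0∞, ∑ j, ENNReal.ofReal (w j) * c = c := fun c => by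
    rw [← Finset.sum_mul, ← ENNReal.ofReal_sum_of_nonneg fun j _ => hw j, hw1]; simp
  -- The negative parts are moved across the inequality, so that no `∞ - ∞` arises on integration.
  have key : ∀ ω, ENNReal.ofReal (F ω) + ∑ j, ENNReal.ofReal (w j) * ENNReal.ofReal (-G j ω) ≤
      ENNReal.ofReal (-F ω) + ∑ j, ENNReal.ofReal (w j) * ENNReal.ofReal (G j ω) := by
    intro ω
    have m : ∀ x : ℝ, ENNReal.ofReal x = ENNReal.ofReal (max x 0) := fun x => by simp
    have e : ∀ f : ι → ℝ, ∑ j, ENNReal.ofReal (w j) * ENNReal.ofReal (f j)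
        = ENNReal.ofReal (∑ j, w j * max (f j) 0) := fun f => by
      rw [ENNReal.ofReal_sum_of_nonneg fun j _ => mul_nonneg (hw j) (le_max_right _ _)]
      refine Finset.sum_congr rfl fun j _ => ?_
      rw [ENNReal.ofReal_mul (hw j), m (f j)]
    have nn : ∀ f : ι → ℝ, 0 ≤ ∑ j, w j * max (f j) 0 := fun f =>
      Finset.sum_nonneg fun j _ => mul_nonneg (hw j) (le_max_right _ _)
    rw [e, e, m (F ω), m (-F ω), ← ENNReal.ofReal_add (le_max_right _ _) (nn _),
      ← ENNReal.ofReal_add (le_max_right _ _) (nn _)]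
    refine ENNReal.ofReal_le_ofReal ?_
    have p : ∀ x : ℝ, max x 0 - max (-x) 0 = x := fun x =>
      max_zero_sub_max_neg_zero_eq_self x
    have : ∑ j, w j * G j ω
        = ∑ j, w j * max (G j ω) 0 - ∑ j, w j * max (-G j ω) 0 := by
      rw [← Finset.sum_sub_distrib]
      exact Finset.sum_congr rfl fun j _ => by rw [← mul_sub, p]
    linarith [hFG ω, p (F ω)]
  have hi := lintegral_mono (μ := P) key
  rw [lintegral_add_left (by fun_prop), lintegral_add_left (by fun_prop),
    lintegral_finsetSum _ (by fun_prop), lintegral_finsetSum _ (by fun_prop)] at hi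
  have c1 : ∀ j, ∫⁻ ω, ENNReal.ofReal (w j) * ENNReal.ofReal (G j ω) ∂P
      = ENNReal.ofReal (w j) * a := fun j => by rw [lintegral_const_mul _ (by fun_prop), ha]
  have c2 : ∀ j, ∫⁻ ω, ENNReal.ofReal (w j) * ENNReal.ofReal (-G j ω) ∂P
      = ENNReal.ofReal (w j) * b := fun j => by rw [lintegral_const_mul _ (by fun_prop), hb]
  simpa only [c1, c2, hsum] using hi

/-- If `b = ∞` the right side is `⊤`; if `a' = ∞` the left side is `⊥`. Otherwise all four terms are
finite and the inequality is one of real numbers. -/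
theorem EReal.coe_ennreal_sub_le_sub_of_add_le {a a' b b' : ℝ≥0∞} (h : a + b' ≤ a' + b)
    (ha : a ≠ ∞ ∨ a' ≠ ∞) (hb : b ≠ ∞ ∨ b' ≠ ∞) :
    (a : EReal) - (a' : EReal) ≤ (b : EReal) - (b' : EReal) := by
  induction b with
  | top =>
    lift b' to NNReal using by simpa using hb
    simp
  | coe b =>
    induction a' with
    | top =>
      lift a to NNReal using by simpa using ha
      simp [EReal.sub_top]
    | coe a' =>
      have hlt : a + b' < ∞ := h.trans_lt (by simp)
      lift a to NNReal using ((le_self_add).trans_lt hlt).ne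
      lift b' to NNReal using ((le_add_self).trans_lt hlt).ne
      have h' : (a : ℝ) + b' ≤ a' + b := by exact_mod_cast h
      have : (a : ℝ) - a' ≤ b - b' := by linarith
      have h3 : ((a : ℝ) : EReal) - (a' : ℝ) ≤ (b : ℝ) - (b' : ℝ) := by exact_mod_cast this
      simpa only [EReal.coe_nnreal_eq_coe_real] using h3

end Expectation

/-! ### Transfer of integrals to the product law of the pair `(X, Z)` -/

section Mixture

variable {n q : ℕ} {Ω : Type*} [MeasurableSpace Ω] {P : Measure Ω}
  {Y : Ω → EuclideanSpace ℝ (Fin n)} {μ δ : EuclideanSpace ℝ (Fin n)}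
  {S : Matrix (Fin n) (Fin n) ℝ} {ψ g : ℝ → ℝ} {α β : EuclideanSpace ℝ (Fin q) → ℝ}
  {H : Measure (EuclideanSpace ℝ (Fin q))} {ν : Measure (EuclideanSpace ℝ (Fin n))}

theorem HasLaw.lintegral_mixture (hα : Measurable α) (hβ : Measurable β)
    (hY : HasLaw Y ((ν.prod H).map (fun p => μ + α p.2 • p.1 + β p.2 • δ)) P)
    {f : EuclideanSpace ℝ (Fin n) → ℝ≥0∞} (hf : Measurable f) :
    ∫⁻ ω, f (Y ω) ∂P = ∫⁻ p, f (μ + α p.2 • p.1 + β p.2 • δ) ∂(ν.prod H) := by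
  rw [← lintegral_map' (f := f) (g := Y) hf.aemeasurable hY.aemeasurable, hY.map_eq,
    lintegral_map hf (by fun_prop)]

theorem HasLaw.integrable_mixture_iff (hα : Measurable α) (hβ : Measurable β)
    (hY : HasLaw Y ((ν.prod H).map (fun p => μ + α p.2 • p.1 + β p.2 • δ)) P)
    {E : Type*} [NormedAddCommGroup E] {f : EuclideanSpace ℝ (Fin n) → E}
    (hf : StronglyMeasurable f) :
    Integrable (fun ω => f (Y ω)) P ↔
      Integrable (fun p => f (μ + α p.2 • p.1 + β p.2 • δ)) (ν.prod H) := by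
  have h1 := integrable_map_measure (f := Y) (μ := P) (g := f) hf.aestronglyMeasurable
    hY.aemeasurable
  rw [hY.map_eq, integrable_map_measure hf.aestronglyMeasurable (by fun_prop)] at h1
  exact h1.symm

theorem HasLaw.integral_mixture (hα : Measurable α) (hβ : Measurable β)
    (hY : HasLaw Y ((ν.prod H).map (fun p => μ + α p.2 • p.1 + β p.2 • δ)) P)
    {E : Type*} [NormedAddCommGroup E] [NormedSpace ℝ E] {f : EuclideanSpace ℝ (Fin n) → E}
    (hf : StronglyMeasurable f) :
    ∫ ω, f (Y ω) ∂P = ∫ p, f (μ + α p.2 • p.1 + β p.2 • δ) ∂(ν.prod H) := by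
  rw [← integral_map (φ := Y) (f := f) hY.aemeasurable hf.aestronglyMeasurable, hY.map_eq,
    integral_map (by fun_prop) hf.aestronglyMeasurable]

theorem Measure.map_fst_prod_eq {E F G : Type*} [MeasurableSpace E] [MeasurableSpace F]
    [MeasurableSpace G] {ν : Measure E} [SFinite ν] {H : Measure F} [SFinite H] {A : E → G}
    (hA : Measurable A) :
    (ν.prod H).map (fun p : E × F => (A p.1, p.2)) = (ν.map A).prod H := by
  have := Measure.map_prod_map ν H hA measurable_id
  rw [Measure.map_id] at this
  exact this.symm

theorem lintegral_prod_map_left {E F G : Type*} [MeasurableSpace E] [MeasurableSpace F]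
    [MeasurableSpace G] {ν : Measure E} [SFinite ν] {H : Measure F} [SFinite H] {A : E → G}
    (hA : Measurable A) {f : G × F → ℝ≥0∞} (hf : Measurable f) :
    ∫⁻ p, f p ∂((ν.map A).prod H) = ∫⁻ p, f (A p.1, p.2) ∂(ν.prod H) := by
  rw [← Measure.map_fst_prod_eq hA, lintegral_map hf (by fun_prop)]

theorem integrable_prod_map_left {E F G : Type*} [MeasurableSpace E] [MeasurableSpace F]
    [MeasurableSpace G] {ν : Measure E} [SFinite ν] {H : Measure F} [SFinite H] {A : E → G}
    (hA : Measurable A) {f : G × F → ℝ} (hf : Measurable f) :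
    Integrable f ((ν.map A).prod H) ↔ Integrable (fun p : E × F => f (A p.1, p.2)) (ν.prod H) := by
  rw [← Measure.map_fst_prod_eq hA, integrable_map_measure (by fun_prop) (by fun_prop)]
  rfl

theorem integral_prod_map_left {E F G : Type*} [MeasurableSpace E] [MeasurableSpace F]
    [MeasurableSpace G] {ν : Measure E} [SFinite ν] {H : Measure F} [SFinite H] {A : E → G}
    (hA : Measurable A) {f : G × F → ℝ} (hf : Measurable f) :
    ∫ p, f p ∂((ν.map A).prod H) = ∫ p, f (A p.1, p.2) ∂(ν.prod H) := by
  rw [← Measure.map_fst_prod_eq hA, integral_map (by fun_prop) (by fun_prop)]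

end Mixture

/-! ### Sufficiency by coupling and Jensen -/

section Sufficiency

variable {n q : ℕ} {Ω₁ Ω₂ : Type*} [MeasurableSpace Ω₁] [MeasurableSpace Ω₂]
  {P₁ : Measure Ω₁} {P₂ : Measure Ω₂}
  {Y₁ : Ω₁ → EuclideanSpace ℝ (Fin n)} {Y₂ : Ω₂ → EuclideanSpace ℝ (Fin n)}
  {μ δ : EuclideanSpace ℝ (Fin n)} {S₁ S₂ : Matrix (Fin n) (Fin n) ℝ}
  {ψ g : ℝ → ℝ} {α β : EuclideanSpace ℝ (Fin q) → ℝ}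
  {H : Measure (EuclideanSpace ℝ (Fin q))}

theorem IsLSE.convexOrder_of_posSemidef (h₁ : IsLSE P₁ Y₁ μ S₁ δ ψ g α β H)
    (h₂ : IsLSE P₂ Y₂ μ S₂ δ ψ g α β H) (hS : (S₂ - S₁).PosSemidef) :
    ConvexOrder P₁ Y₁ P₂ Y₂ := by
  intro f hf hw₁ hw₂
  have hfm : Measurable f := hf.locallyLipschitz.continuous.measurable
  obtain ⟨ν₁, hν₁, -, hY₁⟩ := h₁.representation
  obtain ⟨ν₂, hν₂, -, hY₂⟩ := h₂.representation
  have hα := h₁.measurable_scale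
  have hβ := h₁.measurable_location
  have := h₁.isProbabilityMeasure
  obtain ⟨A, R, d, hRA, hS₂, hS₁, hd⟩ :=
    exists_simultaneous_diagonalization h₁.posDef.posSemidef h₂.posDef hS
  have hν₀ : IsElliptical (ν₂.map (Matrix.toEuclideanCLM (𝕜 := ℝ) R)) 0 1 ψ := by
    have e : R * S₂ * Rᵀ = 1 := by
      calc R * S₂ * Rᵀ = (R * A) * (R * A)ᵀ := by
            rw [hS₂, Matrix.transpose_mul]; simp only [Matrix.mul_assoc]
        _ = 1 := by simp [hRA]
    exact e ▸ hν₂.map_toEuclideanCLM R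
  set ν₀ := ν₂.map (Matrix.toEuclideanCLM (𝕜 := ℝ) R)
  clear_value ν₀
  have := hν₀.isProbabilityMeasure
  -- Only the squares of `w` enter the scale matrix: `w = √d` yields `S₁`, and every sign vector
  -- yields `S₂`.
  have hmap : ∀ w : Fin n → ℝ, IsElliptical
      (ν₀.map (Matrix.toEuclideanCLM (𝕜 := ℝ) (A * Matrix.diagonal w))) 0
      (A * Matrix.diagonal (fun i => w i * w i) * Aᵀ) ψ := fun w => by
    have h := hν₀.map_toEuclideanCLM (A * Matrix.diagonal w)
    convert h using 1
    rw [← Matrix.diagonal_mul_diagonal, Matrix.transpose_mul, Matrix.diagonal_transpose]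
    simp only [Matrix.mul_assoc, Matrix.mul_one]
  obtain ⟨ι, _, w, ε, hw, hw1, hε, hεd⟩ := exists_sum_signs (d := fun i => √(d i)) fun i => by
    rw [abs_of_nonneg (Real.sqrt_nonneg _)]
    exact Real.sqrt_le_one.2 (hd i).2
  have e₁ : ν₁ = ν₀.map (Matrix.toEuclideanCLM (𝕜 := ℝ)
      (A * Matrix.diagonal fun i => √(d i))) := by
    have h := hmap fun i => √(d i)
    simp only [fun i => Real.mul_self_sqrt (hd i).1] at h
    exact (hS₁ ▸ hν₁).ext h
  have e₂ : ∀ j, ν₂ = ν₀.map (Matrix.toEuclideanCLM (𝕜 := ℝ) (A * Matrix.diagonal (ε j))) := by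
    intro j
    have h := hmap (ε j)
    simp only [hε j, Matrix.diagonal_one, Matrix.mul_one] at h
    exact (hS₂ ▸ hν₂).ext h
  let F : (Fin n → ℝ) → EuclideanSpace ℝ (Fin n) × EuclideanSpace ℝ (Fin q) → ℝ := fun v p =>
    f (μ + α p.2 • Matrix.toEuclideanCLM (𝕜 := ℝ) (A * Matrix.diagonal v) p.1 + β p.2 • δ)
  have hF : ∀ v, Measurable (F v) := fun v => by fun_prop
  have hJ : ∀ p, F (fun i => √(d i)) p ≤ ∑ j, w j * F (ε j) p := by
    intro p
    have h := hf.map_sum_le (t := Finset.univ) (w := w) (fun j _ => hw j) hw1 (p := fun j =>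
      μ + α p.2 • Matrix.toEuclideanCLM (𝕜 := ℝ) (A * Matrix.diagonal (ε j)) p.1 + β p.2 • δ)
      (fun _ _ => Set.mem_univ _)
    refine le_trans (le_of_eq ?_) h
    simp only [F]
    congr 1
    have hdiag : Matrix.diagonal (fun i => √(d i)) = ∑ j, w j • Matrix.diagonal (ε j) := by
      rw [← hεd]
      ext a b
      by_cases hab : a = b
      · subst hab; simp [Matrix.sum_apply]
      · simp [Matrix.sum_apply, hab]
    rw [hdiag, Finset.mul_sum]
    simp only [Matrix.mul_smul, map_sum, map_smul, sum_apply,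
      smul_apply, smul_add, Finset.sum_add_distrib, ← Finset.sum_smul, hw1,
      one_smul, Finset.smul_sum, smul_comm (α p.2)]
  have hlow : ∀ (φ : ℝ → ℝ≥0∞), Measurable φ →
      ∫⁻ ω, φ (f (Y₁ ω)) ∂P₁ = ∫⁻ p, φ (F (fun i => √(d i)) p) ∂(ν₀.prod H) := fun φ hφ => by
    rw [HasLaw.lintegral_mixture hα hβ hY₁ (f := fun y => φ (f y)) (hφ.comp hfm), e₁,
      lintegral_prod_map_left (by fun_prop) (by fun_prop)]
  have hup : ∀ (φ : ℝ → ℝ≥0∞), Measurable φ → ∀ j,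
      ∫⁻ p, φ (F (ε j) p) ∂(ν₀.prod H) = ∫⁻ ω, φ (f (Y₂ ω)) ∂P₂ := fun φ hφ j => by
    rw [HasLaw.lintegral_mixture hα hβ hY₂ (f := fun y => φ (f y)) (hφ.comp hfm), e₂ j,
      lintegral_prod_map_left (by fun_prop) (by fun_prop)]
  have key := lintegral_parts_le_of_le_sum (P := ν₀.prod H) hw hw1 (hF _) (fun j => hF (ε j)) hJ
    (hup ENNReal.ofReal (by fun_prop)) (hup (fun x => ENNReal.ofReal (-x)) (by fun_prop))
  rw [← hlow ENNReal.ofReal (by fun_prop), ← hlow (fun x => ENNReal.ofReal (-x)) (by fun_prop)]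
    at key
  exact EReal.coe_ennreal_sub_le_sub_of_add_le key hw₁ hw₂

end Sufficiency

/-! ### Necessity by means and a strictly convex test function -/

section Necessity

variable {n q : ℕ}

/-- Symmetry under `x ↦ -x` suffices. Integrability is not required, as the Bochner integral is 0 by
default. -/
theorem IsElliptical.integral_id_eq_zero {ν : Measure (EuclideanSpace ℝ (Fin n))}
    {S : Matrix (Fin n) (Fin n) ℝ} {ψ : ℝ → ℝ} (h : IsElliptical ν 0 S ψ) :
    ∫ x, x ∂ν = 0 := by
  have e : ∫ x, x ∂ν = ∫ x, -x ∂ν := by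
    conv_lhs => rw [← h.map_neg]
    exact integral_map (by fun_prop) (by fun_prop)
  rw [integral_neg] at e
  have h2 : (2 : ℝ) • ∫ x, x ∂ν = 0 := by
    rw [two_smul]
    exact eq_neg_iff_add_eq_zero.1 e
  exact (smul_eq_zero.1 h2).resolve_left two_ne_zero

/-- Integrability is stated for `β z • δ` and not for `β`, which may fail to be integrable when `δ =
0`. -/
theorem IsLSE.integral_eq {Ω : Type*} [MeasurableSpace Ω] {P : Measure Ω}
    {Y : Ω → EuclideanSpace ℝ (Fin n)} {μ δ : EuclideanSpace ℝ (Fin n)}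
    {S : Matrix (Fin n) (Fin n) ℝ} {ψ g : ℝ → ℝ} {α β : EuclideanSpace ℝ (Fin q) → ℝ}
    {H : Measure (EuclideanSpace ℝ (Fin q))} (h : IsLSE P Y μ S δ ψ g α β H)
    (hY : Integrable Y P) (hα : ¬ ∀ᵐ z ∂H, α z = 0) :
    Integrable (fun z => β z • δ) H ∧ ∫ ω, Y ω ∂P = μ + ∫ z, β z • δ ∂H := by
  obtain ⟨ν, hν, -, hlaw⟩ := h.representation
  have := h.isProbabilityMeasure
  have := hν.isProbabilityMeasure
  have hI := (HasLaw.integrable_mixture_iff h.measurable_scale h.measurable_location hlaw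
    stronglyMeasurable_id).1 hY
  have hE := HasLaw.integral_mixture h.measurable_scale h.measurable_location hlaw
    stronglyMeasurable_id
  simp only [id] at hI hE
  -- By Fubini almost every slice in `z` is integrable, and a single such slice with `α z ≠ 0` makes
  -- `X` integrable.
  have hX : Integrable (fun x => x) ν := by
    by_contra hX
    refine hα ?_
    filter_upwards [hI.prod_left_ae] with z hz
    by_contra hz0
    refine hX ?_
    have h1 : Integrable (fun x => α z • x) ν := by
      refine ((hz.sub (integrable_const (μ + β z • δ))).congr (.of_forall fun x => ?_))
      simp only [Pi.sub_apply]
      abel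
    exact (integrable_fun_smul_iff hz0 _).1 h1
  have hz : ∀ z, ∫ x, (μ + α z • x + β z • δ) ∂ν = μ + β z • δ := fun z => by
    have h1 : Integrable (fun x => α z • x) ν := hX.smul (α z)
    rw [integral_add (f := fun x => μ + α z • x) ((integrable_const _).add h1)
        (integrable_const _),
      integral_add (integrable_const _) h1, integral_smul, hν.integral_id_eq_zero]
    simp
  have hβ : Integrable (fun z => β z • δ) H := by
    refine (hI.integral_prod_right.sub (integrable_const μ)).congr (.of_forall fun z => ?_)
    simp [hz]
  refine ⟨hβ, ?_⟩
  rw [hE, integral_prod_symm _ hI]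
  simp only [hz]
  rw [integral_add (integrable_const _) hβ]
  simp

variable {Ω₁ Ω₂ : Type*} [MeasurableSpace Ω₁] [MeasurableSpace Ω₂]
  {P₁ : Measure Ω₁} {P₂ : Measure Ω₂}
  {Y₁ : Ω₁ → EuclideanSpace ℝ (Fin n)} {Y₂ : Ω₂ → EuclideanSpace ℝ (Fin n)}

theorem ConvexOrder.integral_le (h : ConvexOrder P₁ Y₁ P₂ Y₂) {f : EuclideanSpace ℝ (Fin n) → ℝ}
    (hf : ConvexOn ℝ Set.univ f) (h₁ : Integrable (fun ω => f (Y₁ ω)) P₁)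
    (h₂ : Integrable (fun ω => f (Y₂ ω)) P₂) : ∫ ω, f (Y₁ ω) ∂P₁ ≤ ∫ ω, f (Y₂ ω) ∂P₂ := by
  have := h f hf (Integrable.expectationWellDefined h₁) (Integrable.expectationWellDefined h₂)
  rw [extExpectation_eq_integral h₁, extExpectation_eq_integral h₂] at this
  exact_mod_cast this

/-- Testing with the linear functional given by the difference `t` of the means yields `‖t‖² ≤ 0`.
-/
theorem ConvexOrder.integral_eq (h : ConvexOrder P₁ Y₁ P₂ Y₂) (h₁ : Integrable Y₁ P₁)
    (h₂ : Integrable Y₂ P₂) : ∫ ω, Y₁ ω ∂P₁ = ∫ ω, Y₂ ω ∂P₂ := by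
  set t := ∫ ω, Y₁ ω ∂P₁ - ∫ ω, Y₂ ω ∂P₂ with ht
  have hle := h.integral_le (f := fun y => ⟪t, y⟫)
    ((innerSL ℝ t : EuclideanSpace ℝ (Fin n) →L[ℝ] ℝ).toLinearMap.convexOn convex_univ)
    (h₁.const_inner t) (h₂.const_inner t)
  rw [integral_inner h₁, integral_inner h₂, ← sub_nonpos, ← inner_sub_right, ← ht,
    real_inner_self_eq_norm_sq] at hle
  have : t = 0 := by
    rw [← norm_eq_zero]
    exact pow_eq_zero_iff two_ne_zero |>.1 (le_antisymm hle (sq_nonneg _))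
  exact sub_eq_zero.1 this

theorem strictConvexOn_sqrt_one_add_sq :
    StrictConvexOn ℝ Set.univ fun s : ℝ => √(1 + s ^ 2) := by
  refine ⟨convex_univ, fun a _ b _ hab x y hx hy hxy => ?_⟩
  simp only [smul_eq_mul]
  have ha := Real.sq_sqrt (show 0 ≤ 1 + a ^ 2 by positivity)
  have hb := Real.sq_sqrt (show 0 ≤ 1 + b ^ 2 by positivity)
  have hpos : 0 < √(1 + a ^ 2) := Real.sqrt_pos.2 (by positivity)
  have hposb : 0 < √(1 + b ^ 2) := Real.sqrt_pos.2 (by positivity)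
  -- Strict Cauchy–Schwarz for `(1, a)` and `(1, b)`, which are not parallel since `a ≠ b`.
  have hm : 1 + a * b < √(1 + a ^ 2) * √(1 + b ^ 2) := by
    rw [← Real.sqrt_mul (by positivity)]
    refine Real.lt_sqrt_of_sq_lt ?_
    have := sq_pos_of_ne_zero (sub_ne_zero.2 hab)
    nlinarith
  rw [Real.sqrt_lt' (by positivity)]
  have h2 : (x + y) ^ 2 = 1 := by rw [hxy]; norm_num
  have h3 := mul_lt_mul_of_pos_left hm (mul_pos hx hy)
  calc 1 + (x * a + y * b) ^ 2
      = x ^ 2 * (1 + a ^ 2) + y ^ 2 * (1 + b ^ 2) + 2 * (x * y * (1 + a * b)) := by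
        linear_combination -h2
    _ < x ^ 2 * (1 + a ^ 2) + y ^ 2 * (1 + b ^ 2)
        + 2 * (x * y * (√(1 + a ^ 2) * √(1 + b ^ 2))) := by linarith
    _ = (x * √(1 + a ^ 2) + y * √(1 + b ^ 2)) ^ 2 := by
        linear_combination -x ^ 2 * ha - y ^ 2 * hb

theorem integrable_sqrt_one_add_inner_sq {Ω : Type*} [MeasurableSpace Ω] {P : Measure Ω}
    [IsFiniteMeasure P] {Y : Ω → EuclideanSpace ℝ (Fin n)} (hY : Integrable Y P)
    (t : EuclideanSpace ℝ (Fin n)) : Integrable (fun ω => √(1 + ⟪t, Y ω⟫ ^ 2)) P := by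
  have hc : Continuous fun y : EuclideanSpace ℝ (Fin n) => √(1 + ⟪t, y⟫ ^ 2) := by fun_prop
  refine ((integrable_const (1 : ℝ)).add (hY.const_inner t).abs).mono'
    (hc.comp_aestronglyMeasurable hY.1) (.of_forall fun ω => ?_)
  rw [Real.norm_of_nonneg (Real.sqrt_nonneg _)]
  refine Real.sqrt_le_iff.2 ⟨by simp only [Pi.add_apply]; positivity, ?_⟩
  simp only [Pi.add_apply]
  nlinarith [sq_abs ⟪t, Y ω⟫, abs_nonneg ⟪t, Y ω⟫]

theorem quadForm_sub (A B : Matrix (Fin n) (Fin n) ℝ) (x : EuclideanSpace ℝ (Fin n)) :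
    quadForm (A - B) x = quadForm A x - quadForm B x := by
  simp [quadForm, Matrix.sub_mulVec]

variable {μ δ : EuclideanSpace ℝ (Fin n)} {S₁ S₂ : Matrix (Fin n) (Fin n) ℝ}
  {ψ g : ℝ → ℝ} {α β : EuclideanSpace ℝ (Fin q) → ℝ} {H : Measure (EuclideanSpace ℝ (Fin q))}

/-- Otherwise `⟪t, X₂⟫` has the law of `θ ⟪t, X₁⟫` with `0 ≤ θ < 1`. Shrinking a symmetric variable
lowers the expectation of a strictly convex function strictly, unless `α(Z) ⟪t, X₁⟫ = 0` almost
surely; the density and the hypothesis on `α` rule this out. -/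
theorem IsLSE.quadForm_le_of_convexOrder (h₁ : IsLSE P₁ Y₁ μ S₁ δ ψ g α β H)
    (h₂ : IsLSE P₂ Y₂ μ S₂ δ ψ g α β H) (hY₁ : Integrable Y₁ P₁) (hY₂ : Integrable Y₂ P₂)
    [IsProbabilityMeasure P₁] [IsProbabilityMeasure P₂]
    (hα0 : ¬ ∀ᵐ z ∂H, α z = 0) (h : ConvexOrder P₁ Y₁ P₂ Y₂) (t : EuclideanSpace ℝ (Fin n)) :
    quadForm S₁ t ≤ quadForm S₂ t := by
  by_contra! hlt
  have ht : t ≠ 0 := by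
    rintro rfl
    simp [quadForm] at hlt
  have hq₂ : 0 ≤ quadForm S₂ t := by
    simpa [quadForm] using h₂.posDef.posSemidef.dotProduct_mulVec_nonneg t.ofLp
  have hq₁ := hq₂.trans_lt hlt
  obtain ⟨θ, hθ0, hθ1, hθ⟩ : ∃ θ : ℝ, 0 ≤ θ ∧ θ < 1 ∧ quadForm S₂ t = θ ^ 2 * quadForm S₁ t := by
    refine ⟨√(quadForm S₂ t / quadForm S₁ t), Real.sqrt_nonneg _, ?_, ?_⟩
    · rw [Real.sqrt_lt' one_pos, one_pow, div_lt_one hq₁]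
      exact hlt
    · rw [Real.sq_sqrt (by positivity), div_mul_cancel₀ _ hq₁.ne']
  obtain ⟨ν₁, hν₁, hg, hlaw₁⟩ := h₁.representation
  obtain ⟨ν₂, hν₂, -, hlaw₂⟩ := h₂.representation
  have hα := h₁.measurable_scale
  have hβ := h₁.measurable_location
  have := h₁.isProbabilityMeasure
  have := hν₁.isProbabilityMeasure
  have := hν₂.isProbabilityMeasure
  let φ : ℝ → ℝ := fun s => √(1 + s ^ 2)
  have hφc : Continuous φ := by fun_prop
  have hφ0 : ∀ s, 0 ≤ φ s := fun s => Real.sqrt_nonneg _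
  let f : EuclideanSpace ℝ (Fin n) → ℝ := fun y => φ ⟪t, y⟫
  have hf : ConvexOn ℝ Set.univ f := strictConvexOn_sqrt_one_add_sq.convexOn.comp_linearMap
    (innerSL ℝ t : EuclideanSpace ℝ (Fin n) →L[ℝ] ℝ).toLinearMap
  have hfc : Continuous f := by fun_prop
  have hint₁ : Integrable (fun ω => f (Y₁ ω)) P₁ := integrable_sqrt_one_add_inner_sq hY₁ t
  have hint₂ : Integrable (fun ω => f (Y₂ ω)) P₂ := integrable_sqrt_one_add_inner_sq hY₂ t
  have hle := h.integral_le hf hint₁ hint₂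
  have hI := (HasLaw.integrable_mixture_iff hα hβ hlaw₁ hfc.stronglyMeasurable).1 hint₁
  rw [HasLaw.integral_mixture hα hβ hlaw₁ hfc.stronglyMeasurable,
    HasLaw.integral_mixture hα hβ hlaw₂ hfc.stronglyMeasurable] at hle
  let c : EuclideanSpace ℝ (Fin q) → ℝ := fun z => ⟪t, μ⟫ + β z * ⟪t, δ⟫
  let K : ℝ × EuclideanSpace ℝ (Fin q) → ℝ := fun p => φ (c p.2 + α p.2 * p.1)
  have hK : Measurable K := hφc.measurable.comp (by fun_prop)
  have hfK : ∀ p : EuclideanSpace ℝ (Fin n) × EuclideanSpace ℝ (Fin q),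
      f (μ + α p.2 • p.1 + β p.2 • δ) = K (⟪t, p.1⟫, p.2) := fun p => by
    simp only [f, K, c, inner_add_right, real_inner_smul_right]
    congr 1
    ring
  simp only [hfK] at hle hI
  have hin : Measurable fun x : EuclideanSpace ℝ (Fin n) => ⟪t, x⟫ := by fun_prop
  have e₂ : ∫ p, K (⟪t, p.1⟫, p.2) ∂(ν₂.prod H) = ∫ p, K (θ * ⟪t, p.1⟫, p.2) ∂(ν₁.prod H) := by
    rw [← integral_prod_map_left hin hK, hν₁.map_inner_eq_map_mul hν₂ hθ,
      integral_prod_map_left (hin.const_mul θ) hK]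
  have hsym : ν₁.map (fun x => ⟪t, x⟫) = ν₁.map (fun x => (-1) * ⟪t, x⟫) :=
    hν₁.map_inner_eq_map_mul hν₁ (by norm_num)
  have e₁ : ∫ p, K (⟪t, p.1⟫, p.2) ∂(ν₁.prod H)
      = ∫ p, K ((-1) * ⟪t, p.1⟫, p.2) ∂(ν₁.prod H) := by
    rw [← integral_prod_map_left hin hK, hsym, integral_prod_map_left (hin.const_mul (-1)) hK]
  have hI' : Integrable (fun p : EuclideanSpace ℝ (Fin n) × EuclideanSpace ℝ (Fin q) =>
      K ((-1) * ⟪t, p.1⟫, p.2)) (ν₁.prod H) := by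
    rw [← integrable_prod_map_left (hin.const_mul (-1)) hK, ← hsym,
      integrable_prod_map_left hin hK]
    exact hI
  -- The point `θ s` is the average of `s` and `-s` with weights `(1 ± θ) / 2`, both positive.
  have hcomb : ∀ (s : ℝ) (z : EuclideanSpace ℝ (Fin q)),
      c z + α z * (θ * s) = ((1 + θ) / 2) • (c z + α z * s)
        + ((1 - θ) / 2) • (c z + α z * ((-1) * s)) := fun s z => by
    simp only [smul_eq_mul]
    ring
  have hKle : ∀ (s : ℝ) (z : EuclideanSpace ℝ (Fin q)), K (θ * s, z)
      ≤ (1 + θ) / 2 * K (s, z) + (1 - θ) / 2 * K ((-1) * s, z) := fun s z => by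
    simp only [K, hcomb s z]
    exact strictConvexOn_sqrt_one_add_sq.convexOn.2 (Set.mem_univ _) (Set.mem_univ _)
      (by linarith) (by linarith) (by ring)
  have hKlt : ∀ (s : ℝ) (z : EuclideanSpace ℝ (Fin q)), α z * s ≠ 0 → K (θ * s, z)
      < (1 + θ) / 2 * K (s, z) + (1 - θ) / 2 * K ((-1) * s, z) := fun s z hs => by
    simp only [K, hcomb s z]
    refine strictConvexOn_sqrt_one_add_sq.2 (Set.mem_univ _) (Set.mem_univ _) (fun h => hs ?_)
      (by linarith) (by linarith) (by ring)
    linarith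
  have hsum : Integrable (fun p : EuclideanSpace ℝ (Fin n) × EuclideanSpace ℝ (Fin q) =>
      (1 + θ) / 2 * K (⟪t, p.1⟫, p.2) + (1 - θ) / 2 * K ((-1) * ⟪t, p.1⟫, p.2)) (ν₁.prod H) :=
    (hI.const_mul ((1 + θ) / 2)).add (hI'.const_mul ((1 - θ) / 2))
  have hIθ : Integrable (fun p : EuclideanSpace ℝ (Fin n) × EuclideanSpace ℝ (Fin q) =>
      K (θ * ⟪t, p.1⟫, p.2)) (ν₁.prod H) := by
    refine hsum.mono' (hK.comp (by fun_prop)).aestronglyMeasurable (.of_forall fun p => ?_)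
    rw [Real.norm_of_nonneg (hφ0 _)]
    exact hKle _ _
  have hzero : ∫ p, ((1 + θ) / 2 * K (⟪t, p.1⟫, p.2) + (1 - θ) / 2 * K ((-1) * ⟪t, p.1⟫, p.2)
      - K (θ * ⟪t, p.1⟫, p.2)) ∂(ν₁.prod H) = 0 := by
    refine le_antisymm ?_ (integral_nonneg fun p => sub_nonneg.2 (hKle _ _))
    rw [integral_sub hsum hIθ, integral_add (hI.const_mul _) (hI'.const_mul _),
      integral_const_mul, integral_const_mul, ← e₁, ← e₂]
    linarith
  rw [integral_eq_zero_iff_of_nonneg (fun p => sub_nonneg.2 (hKle _ _)) (hsum.sub hIθ)] at hzero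
  -- The nonnegative Jensen gap integrates to 0, so it vanishes almost everywhere; wherever `⟪t, x⟫
  -- ≠ 0`, strictness would force `α = 0` almost surely.
  have hae : ∀ᵐ x ∂ν₁, ⟪t, x⟫ = 0 := by
    filter_upwards [Measure.ae_ae_of_ae_prod hzero] with x hx
    by_contra hx0
    refine hα0 ?_
    filter_upwards [hx] with z hz
    by_contra hz0
    exact (hKlt _ z (mul_ne_zero hz0 hx0)).ne' (sub_eq_zero.1 hz)
  have hne : ∀ᵐ x ∂ν₁, ⟪t, x⟫ ≠ 0 := by
    rw [ae_iff]
    simpa using hg.measure_inner_eq_zero ht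
  obtain ⟨x, hx, hx'⟩ := (hae.and hne).exists
  exact hx' hx

theorem IsLSE.posSemidef_of_convexOrder (h₁ : IsLSE P₁ Y₁ μ S₁ δ ψ g α β H)
    (h₂ : IsLSE P₂ Y₂ μ S₂ δ ψ g α β H) (hY₁ : Integrable Y₁ P₁) (hY₂ : Integrable Y₂ P₂)
    [IsProbabilityMeasure P₁] [IsProbabilityMeasure P₂]
    (hα0 : ¬ ∀ᵐ z ∂H, α z = 0) (h : ConvexOrder P₁ Y₁ P₂ Y₂) : (S₂ - S₁).PosSemidef := by
  refine Matrix.PosSemidef.of_dotProduct_mulVec_nonneg (h₂.posDef.1.sub h₁.posDef.1) fun x => ?_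
  have := h₁.quadForm_le_of_convexOrder h₂ hY₁ hY₂ hα0 h (WithLp.toLp 2 x)
  rw [← sub_nonneg, ← quadForm_sub] at this
  simpa [quadForm] using this

/-- If `β` is integrable, its integral is nonzero and cancels; if not, integrability of `β z • δ`
forces both vectors to be 0. -/
theorem eq_of_integral_smul_eq {E Z : Type*} [NormedAddCommGroup E] [NormedSpace ℝ E]
    [CompleteSpace E] [MeasurableSpace Z] {H : Measure Z} {β : Z → ℝ} (hβ : ∀ z, 0 ≤ β z)
    (hβ0 : ¬ ∀ᵐ z ∂H, β z = 0) {δ₁ δ₂ : E} (h₁ : Integrable (fun z => β z • δ₁) H)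
    (h₂ : Integrable (fun z => β z • δ₂) H)
    (h : ∫ z, β z • δ₁ ∂H = ∫ z, β z • δ₂ ∂H) : δ₁ = δ₂ := by
  by_cases hβi : Integrable β H
  · rw [integral_smul_const, integral_smul_const] at h
    refine smul_right_injective E (fun h0 => hβ0 ?_) h
    exact (integral_eq_zero_iff_of_nonneg hβ hβi).1 h0
  · have e : ∀ δ : E, Integrable (fun z => β z • δ) H → δ = 0 := fun δ hδ => by
      by_contra h0
      exact hβi ((integrable_smul_const h0).1 hδ)
    rw [e _ h₁, e _ h₂]

end Necessity

theorem mainTheorem2 {n q : ℕ}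
    {Ω₁ Ω₂ : Type*} [MeasurableSpace Ω₁] [MeasurableSpace Ω₂]
    (P₁ : Measure Ω₁) [IsProbabilityMeasure P₁] (P₂ : Measure Ω₂) [IsProbabilityMeasure P₂]
    (Y₁ : Ω₁ → EuclideanSpace ℝ (Fin n)) (Y₂ : Ω₂ → EuclideanSpace ℝ (Fin n))
    (μ₁ μ₂ δ₁ δ₂ : EuclideanSpace ℝ (Fin n)) (S₁ S₂ : Matrix (Fin n) (Fin n) ℝ)
    (ψ g : ℝ → ℝ) (α β : EuclideanSpace ℝ (Fin q) → ℝ)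
    (H : Measure (EuclideanSpace ℝ (Fin q)))
    (h₁ : IsLSE P₁ Y₁ μ₁ S₁ δ₁ ψ g α β H) (h₂ : IsLSE P₂ Y₂ μ₂ S₂ δ₂ ψ g α β H) :
    (μ₁ = μ₂ → δ₁ = δ₂ → (S₂ - S₁).PosSemidef → ConvexOrder P₁ Y₁ P₂ Y₂) ∧
    (Integrable Y₁ P₁ → Integrable Y₂ P₂ → ¬ (∀ᵐ z ∂H, α z = 0) → ¬ (∀ᵐ z ∂H, β z = 0) →
      μ₁ = μ₂ → (ConvexOrder P₁ Y₁ P₂ Y₂ ↔ δ₁ = δ₂ ∧ (S₂ - S₁).PosSemidef)) ∧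
    (Integrable Y₁ P₁ → Integrable Y₂ P₂ → ¬ (∀ᵐ z ∂H, α z = 0) →
      δ₁ = δ₂ → (ConvexOrder P₁ Y₁ P₂ Y₂ ↔ μ₁ = μ₂ ∧ (S₂ - S₁).PosSemidef)) := by
  refine ⟨?_, ?_, ?_⟩
  · rintro rfl rfl hS
    exact h₁.convexOrder_of_posSemidef h₂ hS
  · rintro hY₁ hY₂ hα hβ rfl
    refine ⟨fun h => ?_, ?_⟩
    · obtain ⟨i₁, m₁⟩ := h₁.integral_eq hY₁ hα
      obtain ⟨i₂, m₂⟩ := h₂.integral_eq hY₂ hα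
      have hm := h.integral_eq hY₁ hY₂
      rw [m₁, m₂] at hm
      have hδ := eq_of_integral_smul_eq h₁.location_nonneg hβ i₁ i₂ (add_left_cancel hm)
      subst hδ
      exact ⟨rfl, h₁.posSemidef_of_convexOrder h₂ hY₁ hY₂ hα h⟩
    · rintro ⟨rfl, hS⟩
      exact h₁.convexOrder_of_posSemidef h₂ hS
  · rintro hY₁ hY₂ hα rfl
    refine ⟨fun h => ?_, ?_⟩
    · have hm := h.integral_eq hY₁ hY₂
      rw [(h₁.integral_eq hY₁ hα).2, (h₂.integral_eq hY₂ hα).2] at hm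
      have hμ := add_right_cancel hm
      subst hμ
      exact ⟨rfl, h₁.posSemidef_of_convexOrder h₂ hY₁ hY₂ hα h⟩
    · rintro ⟨rfl, hS⟩
      exact h₁.convexOrder_of_posSemidef h₂ hS
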